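/- **Conventions.** A represented space is a set $X$ with a surjective partial map $\delta_X:\subseteq\mathbb N^{\mathbb N}\to X$; if $\delta_X(p)=x$, then $p$ is called a name of $x$. A partial multi-valued map $f:\subseteq X\rightrightarrows Y$ assigns to each $x\in X$ a set $f(x)\subseteq Y$, with $\mathrm{dom}(f)=\{x: f(x)\neq\emptyset\}$. A partial function $F:\subseteq\mathbb N^{\mathbb N}\to\mathbb N^{\mathbb N}$ is a realizer of $f$, written $F\vdash f$, if for every name $p$ of a point $x\in\mathrm{dom}(f)$ the value $F(p)$ is defined and is a name of an element of $f(x)$. For $p,q\in\mathbb N^{\mathbb N}$ let $\langle p,q\rangle(2n)=p(n)$ and $\langle p,q\rangle(2n+1)=q(n)$. We write $f\le_{\mathrm W} g$ if there are computable partial functions $K,H:\subseteq\mathbb N^{\mathbb N}\to\mathbb N^{\mathbb N}$ (in the sense of Type-2 machines) such that $K\langle \mathrm{id},GH\rangle\vdash f$ for all $G\vdash g$. Moreover, $f\equiv_{\mathrm W}g$ means $f\le_{\mathrm W}g$ and $g\le_{\mathrm W}f$, and $f<_{\mathrm W}g$ means $f\le_{\mathrm W}g$ and $g\not\le_{\mathrm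 W}f$. The product is $(f\times g)(x,z)=f(x)\times g(z)$, where $\langle p,q\rangle$ is a name of $(x,z)$ iff $p$ is a name of $x$ and $q$ is a name of $z$. The map $f$ is called idempotent if $f\equiv_{\mathrm W}f\times f$. The spaces $[0,1]$ and $\mathcal C([0,1],\mathbb R)$ (with the supremum metric) carry their Cauchy representations: a name of $x$ is a sequence of indices, in a standard enumeration of the rational points (respectively of the polynomials with rational coefficients), of a sequence $(a_i)$ with $d(a_i,a_k)\le 2^{-i}$ for all $i<k$ and $\lim_i a_i=x$. The space $\mathcal C([0,1],[0,1])$ is represented as a subspace of $\mathcal C([0,1],\mathbb R)$. Let $$\mathrm{BFT}_1:\mathcal C([0,1],[0,1])\rightrightarrows[0,1],\qquad \mathrm{BFT}_1(f)=\{x\in[0,1]: f(x)=x\},$$ $$\mathrm{IVT}:\subseteq\mathcal C([0,1],\mathbb R)\rightrightarrows[0,1],\qquad \mathrm{IVT}(f)=\{x\in[0,1]: f(x)=0\},\qquad \mathrm{dom}(\mathrm{IVT})=\{f: f(0)\cdot f(1)<0\}.$$ **Corollary 7.4.** The one-dimensional Brouwer Fixed Point Theorem $\mathrm{BFT}_1$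 and the Intermediate Value Theorem $\mathrm{IVT}$ are both not idempotent: $\mathrm{BFT}_1\not\equiv_{\mathrm W}\mathrm{BFT}_1\times\mathrm{BFT}_1$ and $\mathrm{IVT}\not\equiv_{\mathrm W}\mathrm{IVT}\times\mathrm{IVT}$. Moreover, two parallel instances are strictly stronger than one: $\mathrm{BFT}_1<_{\mathrm W}\mathrm{BFT}_1\times\mathrm{BFT}_1$ and $\mathrm{IVT}<_{\mathrm W}\mathrm{IVT}\times\mathrm{IVT}$. -/

import Mathlib

open Filter Topology

namespace Weihrauch

/-- Baire space `ℕ^ℕ`. -/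
abbrev Baire : Type := ℕ → ℕ

/-- The standard pairing on Baire space: `⟨p, q⟩(2n) = p(n)` and `⟨p, q⟩(2n+1) = q(n)`. -/
def pairing (p q : Baire) : Baire := fun m => if m % 2 = 0 then p (m / 2) else q (m / 2)

/-- The finite word consisting of the first `k` values of `p`. -/
def initialWord (p : Baire) (k : ℕ) : List ℕ := (List.range k).map p

/-- Computability of a partial function on Baire space. A Type-2 machine is given by the computable
prefix-monotone word function `h` that sends a word `w` to the output which the machine has written
within `|w|` steps on an input that starts with `w`. The function computed by the machine is defined
exactly at those `p` at which the words `h (p↾k)` grow to an infinite sequence, and this sequence is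
its value. -/
def IsComputable (F : Baire →. Baire) : Prop :=
  ∃ h : List ℕ → List ℕ, Computable h ∧ (∀ u v, u <+: v → h u <+: h v) ∧
    ∀ p q : Baire, q ∈ F p ↔ ∀ n, ∃ k, (h (initialWord p k))[n]? = some (q n)

/-- A represented space: a set `X` with a surjective partial map `δ` from Baire space to `X`.
The partial map is given by its graph, `names p x` meaning `δ(p) = x`. -/
class RepresentedSpace (X : Type) where
  names : Baire → X → Prop
  unique : ∀ {p x y}, names p x → names p y → x = y
  surj : ∀ x, ∃ p, names p x

/-- Partial multi-valued maps; the domain is the set of points with a non-empty set of values. -/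
abbrev MultiMap (X Y : Type) : Type := X → Set Y

/-- `F` is a realizer of `f`: `δ_Y F(p) ∈ f δ_X(p)` for all `p ∈ dom(f δ_X)`; in particular
`F(p)` and `δ_Y F(p)` have to be defined for these `p`. -/
def Realizes {X Y : Type} [RepresentedSpace X] [RepresentedSpace Y]
    (F : Baire →. Baire) (f : MultiMap X Y) : Prop :=
  ∀ p x, RepresentedSpace.names p x → (f x).Nonempty →
    ∃ q ∈ F p, ∃ y, RepresentedSpace.names q y ∧ y ∈ f x

/-- The partial function `K ∘ ⟨id, G ∘ H⟩`. -/
def sandwich (K G H : Baire →. Baire) : Baire →. Baire :=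
  fun p => (H p).bind fun r => (G r).bind fun q => K (pairing p q)

section

variable {X Y Z W : Type} [RepresentedSpace X] [RepresentedSpace Y] [RepresentedSpace Z]
  [RepresentedSpace W]

/-- Weihrauch reducibility `f ≤_W g`. -/
def Reducible (f : MultiMap X Y) (g : MultiMap Z W) : Prop :=
  ∃ K H : Baire →. Baire, IsComputable K ∧ IsComputable H ∧
    ∀ G : Baire →. Baire, Realizes G g → Realizes (sandwich K G H) f

/-- Weihrauch equivalence `f ≡_W g`. -/
def Equivalent (f : MultiMap X Y) (g : MultiMap Z W) : Prop :=
  Reducible f g ∧ Reducible g f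

/-- Strict Weihrauch reducibility `f <_W g`. -/
def StrictlyReducible (f : MultiMap X Y) (g : MultiMap Z W) : Prop :=
  Reducible f g ∧ ¬ Reducible g f

end

theorem pairing_even (p q : Baire) : (fun n => pairing p q (2 * n)) = p := by
  funext n
  simp [pairing]

theorem pairing_odd (p q : Baire) : (fun n => pairing p q (2 * n + 1)) = q := by
  funext n
  have h1 : (2 * n + 1) % 2 = 1 := by omega
  have h2 : (2 * n + 1) / 2 = n := by omega
  simp [pairing, h1, h2]

/-- The product representation: `⟨p, q⟩` is a name of `(x, y)` iff `p` is a name of `x` and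
`q` is a name of `y`. -/
instance {X Y : Type} [RepresentedSpace X] [RepresentedSpace Y] : RepresentedSpace (X × Y) where
  names r z := RepresentedSpace.names (fun n => r (2 * n)) z.1 ∧
    RepresentedSpace.names (fun n => r (2 * n + 1)) z.2
  unique h h' := Prod.ext (RepresentedSpace.unique h.1 h'.1) (RepresentedSpace.unique h.2 h'.2)
  surj z := by
    obtain ⟨p, hp⟩ := RepresentedSpace.surj z.1
    obtain ⟨q, hq⟩ := RepresentedSpace.surj z.2
    exact ⟨pairing p q, by rwa [pairing_even], by rwa [pairing_odd]⟩

/-- The product `(f × g)(x, z) = f(x) × g(z)`. -/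
def prod {X Y Z W : Type} (f : MultiMap X Y) (g : MultiMap Z W) : MultiMap (X × Z) (Y × W) :=
  fun a => f a.1 ×ˢ g a.2

/-- `f` is idempotent if `f ≡_W f × f`. -/
def Idempotent {X Y : Type} [RepresentedSpace X] [RepresentedSpace Y] (f : MultiMap X Y) : Prop :=
  Equivalent f (prod f f)

/-- `p` is a Cauchy name of `x` with respect to the sequence `α`: the sequence `α(p(i))` converges
rapidly to `x`. -/
def CauchyNames {X : Type} [MetricSpace X] (α : ℕ → X) (p : Baire) (x : X) : Prop :=
  (∀ i k, i < k → dist (α (p i)) (α (p k)) ≤ (1 / 2 : ℝ) ^ i) ∧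
    Tendsto (fun i => α (p i)) atTop (𝓝 x)

/-- The Cauchy representation of a metric space with a dense sequence. -/
abbrev cauchyRepresentation {X : Type} [MetricSpace X] (α : ℕ → X) (hα : DenseRange α) :
    RepresentedSpace X where
  names := CauchyNames α
  unique h h' := tendsto_nhds_unique h.2 h'.2
  surj x := by
    have h : ∀ i : ℕ, ∃ n, dist x (α n) < (1 / 2 : ℝ) ^ (i + 1) := fun i =>
      hα.exists_dist_lt x (by positivity)
    choose p hp using h
    refine ⟨p, fun i k hik => ?_, ?_⟩
    · have h1 := hp i
      have h2 := hp k
      have h3 : (1 / 2 : ℝ) ^ (k + 1) ≤ (1 / 2 : ℝ) ^ (i + 1) :=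
        pow_le_pow_of_le_one (by norm_num) (by norm_num) (by omega)
      have h4 := dist_triangle_left (α (p i)) (α (p k)) x
      have h5 : (1 / 2 : ℝ) ^ (i + 1) + (1 / 2 : ℝ) ^ (i + 1) = (1 / 2 : ℝ) ^ i := by ring
      linarith
    · rw [tendsto_iff_dist_tendsto_zero]
      refine squeeze_zero (fun _ => dist_nonneg)
        (fun i => (dist_comm (α (p i)) x).le.trans (hp i).le) ?_
      exact (tendsto_pow_atTop_nhds_zero_of_lt_one (by norm_num) (by norm_num)).comp
        (tendsto_add_atTop_nat 1)

/-- An effective enumeration of the rational numbers (with repetitions): the code of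
`(a - b) / (d + 1)` is `⟨⟨a, b⟩, d⟩` with respect to `Nat.pair`. -/
def ratOfNat (c : ℕ) : ℚ :=
  ((c.unpair.1.unpair.1 : ℚ) - (c.unpair.1.unpair.2 : ℚ)) / ((c.unpair.2 : ℚ) + 1)

theorem ratOfNat_surjective : Function.Surjective ratOfNat := by
  intro r
  refine ⟨Nat.pair (Nat.pair r.num.toNat (-r.num).toNat) (r.den - 1), ?_⟩
  have hd : ((r.den - 1 : ℕ) : ℚ) + 1 = r.den := by
    have := r.den_pos
    exact_mod_cast Nat.sub_add_cancel this
  have hn : ((r.num.toNat : ℕ) : ℚ) - (((-r.num).toNat : ℕ) : ℚ) = r.num := by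
    have h : ((r.num.toNat : ℕ) : ℤ) - (((-r.num).toNat : ℕ) : ℤ) = r.num := by omega
    exact_mod_cast h
  simp only [ratOfNat, Nat.unpair_pair, hd, hn]
  exact Rat.num_div_den r

/-- An effective enumeration of the rational points of `[0,1]` (rationals outside are moved to the
nearest end point). -/
noncomputable def ratPoint (n : ℕ) : unitInterval :=
  Set.projIcc (0 : ℝ) 1 zero_le_one (ratOfNat n : ℝ)

theorem ratPoint_dense : DenseRange ratPoint := by
  have h1 : DenseRange (fun n => (ratOfNat n : ℝ)) := by
    rw [DenseRange, show Set.range (fun n => (ratOfNat n : ℝ)) = Set.range (fun r : ℚ => (r : ℝ))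
      from ratOfNat_surjective.range_comp (fun r : ℚ => (r : ℝ))]
    exact Rat.denseRange_cast
  exact (Set.projIcc_surjective (zero_le_one (α := ℝ))).denseRange.comp h1 continuous_projIcc

/-- The unit interval with its Cauchy representation. -/
noncomputable instance : RepresentedSpace unitInterval :=
  cauchyRepresentation ratPoint ratPoint_dense

/-- The rational polynomial whose list of coefficients (constant term first) is coded by the
list `l`. -/
noncomputable def polyOfList (l : List ℕ) : Polynomial ℚ :=
  l.foldr (fun c P => Polynomial.C (ratOfNat c) + Polynomial.X * P) 0

theorem polyOfList_surjective : Function.Surjective polyOfList := by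
  intro P
  induction P using Polynomial.recOnHorner with
  | M0 => exact ⟨[], rfl⟩
  | MC p a _ _ ih =>
    obtain ⟨l, rfl⟩ := ih
    cases l with
    | nil =>
      obtain ⟨c, hc⟩ := ratOfNat_surjective a
      exact ⟨[c], by simp [polyOfList, hc]⟩
    | cons b l =>
      obtain ⟨c, hc⟩ := ratOfNat_surjective (ratOfNat b + a)
      refine ⟨c :: l, ?_⟩
      simp only [polyOfList, List.foldr_cons, hc, map_add]
      ring
  | MX p _ ih =>
    obtain ⟨l, rfl⟩ := ih
    obtain ⟨c, hc⟩ := ratOfNat_surjective 0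
    refine ⟨c :: l, ?_⟩
    simp only [polyOfList, List.foldr_cons, hc, map_zero]
    ring

/-- The function `[0,1] → ℝ` given by a rational polynomial. -/
noncomputable def polyFun : Polynomial ℚ →+* C(unitInterval, ℝ) :=
  ((Polynomial.toContinuousMapOnAlgHom (Set.Icc (0 : ℝ) 1)) : Polynomial ℝ →+* _).comp
    (Polynomial.mapRingHom (Rat.castHom ℝ))

theorem polyFun_apply (P : Polynomial ℚ) (x : unitInterval) :
    polyFun P x = (P.map (Rat.castHom ℝ)).eval (x : ℝ) := rfl

theorem polyFun_dense : DenseRange polyFun := by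
  let S : Subring C(unitInterval, ℝ) := polyFun.range.topologicalClosure
  have hS : ∀ P : Polynomial ℝ,
      (Polynomial.toContinuousMapOnAlgHom (Set.Icc (0 : ℝ) 1) P : C(unitInterval, ℝ)) ∈ S := by
    have hX : (Polynomial.toContinuousMapOnAlgHom (Set.Icc (0 : ℝ) 1) Polynomial.X :
        C(unitInterval, ℝ)) ∈ S := by
      refine Subring.le_topologicalClosure _ ⟨Polynomial.X, ?_⟩
      simp [polyFun]
    have hC : ∀ a : ℝ, (Polynomial.toContinuousMapOnAlgHom (Set.Icc (0 : ℝ) 1) (Polynomial.C a) :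
        C(unitInterval, ℝ)) ∈ S := by
      intro a
      have hcont : Continuous fun a : ℝ =>
          (Polynomial.toContinuousMapOnAlgHom (Set.Icc (0 : ℝ) 1) (Polynomial.C a) :
            C(unitInterval, ℝ)) := by
        have : (fun a : ℝ =>
          (Polynomial.toContinuousMapOnAlgHom (Set.Icc (0 : ℝ) 1) (Polynomial.C a) :
            C(unitInterval, ℝ))) = fun a => ContinuousMap.const _ a := by
          funext a
          ext x
          simp
        rw [this]
        exact ContinuousMap.continuous_const'
      have hcl : IsClosed (S : Set C(unitInterval, ℝ)) := Subring.isClosed_topologicalClosure _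
      have hr : Set.range (fun r : ℚ => (r : ℝ)) ⊆ {a : ℝ |
          (Polynomial.toContinuousMapOnAlgHom (Set.Icc (0 : ℝ) 1) (Polynomial.C a) :
            C(unitInterval, ℝ)) ∈ S} := by
        rintro _ ⟨r, rfl⟩
        refine Subring.le_topologicalClosure _ ⟨Polynomial.C r, ?_⟩
        simp [polyFun]
      exact closure_minimal hr (hcl.preimage hcont) (Rat.denseRange_cast (𝕜 := ℝ) a)
    intro P
    induction P using Polynomial.induction_on' with
    | add p q hp hq => rw [map_add]; exact S.add_mem hp hq
    | monomial n a =>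
      rw [← Polynomial.C_mul_X_pow_eq_monomial, map_mul, map_pow]
      exact S.mul_mem (hC a) (S.pow_mem hX n)
  intro f
  have hf : f ∈ (polynomialFunctions (Set.Icc (0 : ℝ) 1)).topologicalClosure := by
    rw [polynomialFunctions_closure_eq_top]
    trivial
  have hsub : ((polynomialFunctions (Set.Icc (0 : ℝ) 1) : Subalgebra ℝ C(unitInterval, ℝ)) :
      Set C(unitInterval, ℝ)) ⊆ (S : Set C(unitInterval, ℝ)) := by
    rintro _ ⟨P, _, rfl⟩
    exact hS P
  exact closure_minimal hsub (Subring.isClosed_topologicalClosure _) hf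

/-- An effective enumeration of the rational polynomials, as functions on `[0,1]`. -/
noncomputable def polySeq (n : ℕ) : C(unitInterval, ℝ) :=
  polyFun (polyOfList (Denumerable.ofNat (List ℕ) n))

theorem polySeq_dense : DenseRange polySeq := by
  have h : Function.Surjective fun n : ℕ => polyOfList (Denumerable.ofNat (List ℕ) n) :=
    polyOfList_surjective.comp (fun l => ⟨Encodable.encode l, Denumerable.ofNat_encode l⟩)
  rw [DenseRange, show Set.range polySeq = Set.range polyFun from h.range_comp polyFun]
  exact polyFun_dense

/-- The space `C([0,1], ℝ)` with the supremum metric and its Cauchy representation by means of the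
rational polynomials. -/
noncomputable instance : RepresentedSpace C(unitInterval, ℝ) :=
  cauchyRepresentation polySeq polySeq_dense

/-- A function `[0,1] → [0,1]` regarded as a real-valued function. -/
def toReal (f : C(unitInterval, unitInterval)) : C(unitInterval, ℝ) :=
  ⟨fun x => (f x : ℝ), by fun_prop⟩

/-- The space `C([0,1], [0,1])` as a subspace of the represented space `C([0,1], ℝ)`. -/
noncomputable instance : RepresentedSpace C(unitInterval, unitInterval) where
  names p f := RepresentedSpace.names p (toReal f)
  unique {_ f g} h h' := by
    have := RepresentedSpace.unique h h'
    ext x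
    exact DFunLike.congr_fun this x
  surj f := RepresentedSpace.surj (toReal f)

/-- The one-dimensional Brouwer Fixed Point Theorem `BFT₁ : C([0,1], [0,1]) ⇉ [0,1]`, which maps
`f` to the set of its fixed points. -/
def BFT1 : MultiMap C(unitInterval, unitInterval) unitInterval :=
  fun f => {x | f x = x}

/-- The Intermediate Value Theorem `IVT :⊆ C([0,1], ℝ) ⇉ [0,1]`, which maps `f` to the set of its
zeros, with domain `{f | f(0) · f(1) < 0}`. -/
def IVT : MultiMap C(unitInterval, ℝ) unitInterval :=
  fun f => {x | f 0 * f 1 < 0 ∧ f x = 0}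

end Weihrauch

/-! Duplicating the input reduces each problem to its square, so the content is that the square does
not reduce back. Two properties exclude this (`not_reducible_prod`). First, solutions are zeros of a
continuous function with opposite signs at the end points (`Crossing`). Second, some instance has
arbitrarily small perturbations with any prescribed `t` in `[1/3, 2/3]` as only solution (`Wobbly`).
Here computability enters only as continuity.

Suppose `f × f` reduces to `g`. Near the pair of wobbly instances, compactness of `[0,1]` makes
outputs close whenever the solutions of the translated instances are close (`exists_compact_names`,
`outputs_close`). Cut `[0,1]` into cells so small that solutions in one cell give outputs within
`1/6`, and perturb the first component to have `t` as only solution. If no grid point solved the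
translated instance, its function would change sign strictly across some cell. It would still do so
after tiny perturbations of the second component towards the unique solutions `1/3` and `2/3`,
giving outputs that are both close and `1/3` apart. So some grid point is a solution for every `t`.
With more values of `t` than grid points, two values share one, although a common solution forces
close outputs. -/

namespace Weihrauch

/-! ### Continuity on Baire space and the meaning of a reduction. -/

/-- `p` and `p'` have the same first `N` values. -/
def Agree (N : ℕ) (p p' : Baire) : Prop := ∀ i < N, p i = p' i

theorem Agree.symm {N : ℕ} {p p' : Baire} (h : Agree N p p') : Agree N p' p :=
  fun i hi => (h i hi).symm

theorem Agree.trans {N : ℕ} {p q r : Baire} (h : Agree N p q) (h' : Agree N q r) : Agree N p r :=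
  fun i hi => (h i hi).trans (h' i hi)

theorem Agree.mono {M N : ℕ} {p p' : Baire} (h : Agree N p p') (hMN : M ≤ N) : Agree M p p' :=
  fun i hi => h i (hi.trans_le hMN)

theorem Agree.refl (N : ℕ) (p : Baire) : Agree N p p := fun _ _ => rfl

theorem Agree.pairing {N : ℕ} {p p' q q' : Baire} (hp : Agree N p p') (hq : Agree N q q') :
    Agree N (pairing p q) (pairing p' q') := by
  intro i hi
  have : i / 2 < N := by omega
  simp only [Weihrauch.pairing, hp _ this, hq _ this]

theorem initialWord_prefix (p : Baire) {k l : ℕ} (h : k ≤ l) :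
    initialWord p k <+: initialWord p l := by
  refine List.IsPrefix.map p ?_
  obtain ⟨m, rfl⟩ := Nat.exists_eq_add_of_le h
  exact ⟨_, (List.range_add).symm⟩

theorem Agree.initialWord_eq {N : ℕ} {p p' : Baire} (h : Agree N p p') :
    initialWord p N = initialWord p' N :=
  List.map_congr_left fun i hi => h i (List.mem_range.1 hi)

theorem getElem?_of_prefix {u v : List ℕ} (h : u <+: v) {n a : ℕ} (ha : u[n]? = some a) :
    v[n]? = some a := by
  obtain ⟨t, rfl⟩ := h
  rw [List.getElem?_append_left, ha]
  exact (List.getElem?_eq_some_iff.1 ha).1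

/-- Computable functions on Baire space are continuous. -/
theorem IsComputable.continuous {F : Baire →. Baire} (hF : IsComputable F) {p q : Baire}
    (hq : q ∈ F p) (n : ℕ) :
    ∃ k, ∀ p' q', Agree k p' p → q' ∈ F p' → Agree n q' q := by
  obtain ⟨h, -, hmono, hspec⟩ := hF
  choose k hk using (hspec p q).1 hq
  refine ⟨(Finset.range n).sup k, fun p' q' hp hq' i hi => ?_⟩
  have hle : k i ≤ (Finset.range n).sup k := Finset.le_sup (Finset.mem_range.2 hi)
  obtain ⟨k', hk'⟩ := (hspec p' q').1 hq' i
  have h1 := hk i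
  rw [← (hp.mono hle).initialWord_eq] at h1
  have h2 := getElem?_of_prefix (hmono _ _ (initialWord_prefix p' (le_max_left (k i) k'))) h1
  have h3 := getElem?_of_prefix (hmono _ _ (initialWord_prefix p' (le_max_right (k i) k'))) hk'
  exact Option.some_injective _ (h3.symm.trans h2)

/-- Reading the input along a primitive recursive map of positions is computable. -/
theorem isComputable_reindex {φ : ℕ → ℕ} (hφ : Primrec φ) (hb : ∀ n, φ n < 4 * n + 4) :
    IsComputable fun p => Part.some fun n => p (φ n) := by
  have hlen : ∀ {n l : ℕ}, n < l / 4 → φ n < l := fun {n l} h => by have := hb n; omega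
  have hget : ∀ (w : List ℕ) (n : ℕ), n < w.length / 4 →
      ((List.range (w.length / 4)).map fun n => w.getD (φ n) 0)[n]? = w[φ n]? := by
    intro w n hn
    simp [hn, hlen hn]
  -- By `hb`, a word of length `l` contains every position `φ n` with `n < l / 4`, so the default
  -- `0` is never output.
  refine ⟨fun w => (List.range (w.length / 4)).map fun n => w.getD (φ n) 0, ?_, ?_, ?_⟩
  · refine Primrec.to_comp (Primrec.list_map (Primrec.list_range.comp
      (Primrec.nat_div.comp Primrec.list_length (Primrec.const 4))) ?_)
    exact (Primrec.list_getD 0).comp Primrec.fst (hφ.comp Primrec.snd)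
  · intro u v huv
    rw [List.prefix_iff_getElem?]
    intro i hi
    have hi' : i < u.length / 4 := by simpa using hi
    have hiv : i < v.length / 4 := hi'.trans_le (Nat.div_le_div_right huv.length_le)
    rw [hget v i hiv, ← List.getElem?_eq_getElem hi, hget u i hi',
      List.getElem?_eq_getElem (hlen hi')]
    exact getElem?_of_prefix huv (List.getElem?_eq_getElem _)
  · intro p q
    have hword : ∀ n k, n < k / 4 → ((List.range ((initialWord p k).length / 4)).map
        fun n => (initialWord p k).getD (φ n) 0)[n]? = some (p (φ n)) := by
      intro n k hn
      have hl : (initialWord p k).length = k := by simp [initialWord]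
      rw [hget _ _ (by rwa [hl])]
      simp [initialWord, hlen hn]
    rw [Part.mem_some_iff]
    constructor
    · rintro rfl n
      exact ⟨4 * n + 4, hword n _ (by omega)⟩
    · intro h
      funext n
      obtain ⟨k, hk⟩ := h n
      by_cases hn : n < k / 4
      · exact Option.some_injective _ (hk.symm.trans (hword n k hn))
      · have hl : (initialWord p k).length = k := by simp [initialWord]
        simp [hl, hn] at hk

/-- Every problem is reducible to its square. -/
theorem reducible_prod_self {X Y : Type} [RepresentedSpace X] [RepresentedSpace Y]
    (f : MultiMap X Y) : Reducible f (prod f f) := by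
  -- Position `4n + 1` of `⟨p, q⟩` is `q(2n)`, the first component of the answer; reading at `n / 2`
  -- turns `p` into `⟨p, p⟩`.
  have hK : Primrec fun n : ℕ => 4 * n + 1 :=
    Primrec.succ.comp (Primrec.nat_mul.comp (Primrec.const 4) Primrec.id)
  have hH : Primrec fun n : ℕ => n / 2 := Primrec.nat_div.comp Primrec.id (Primrec.const 2)
  refine ⟨_, _, isComputable_reindex hK fun n => by omega,
    isComputable_reindex hH fun n => by omega, fun G hG p x hp hx => ?_⟩
  have hname : RepresentedSpace.names (fun n => p (n / 2)) (x, x) := by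
    refine ⟨?_, ?_⟩
    · simpa using hp
    · have : (fun n => p ((2 * n + 1) / 2)) = p := by
        funext n
        congr 1
        omega
      simpa only [this] using hp
  obtain ⟨q, hq, y, hqy, hy⟩ := hG _ _ hname (hx.prod hx)
  refine ⟨fun n => q (2 * n), ?_, y.1, hqy.1, hy.1⟩
  simp only [sandwich, Part.bind_some, Part.mem_bind_iff]
  refine ⟨q, hq, ?_⟩
  rw [Part.mem_some_iff]
  funext n
  have h1 : (4 * n + 1) % 2 = 1 := by omega
  have h2 : (4 * n + 1) / 2 = 2 * n := by omega
  simp [pairing, h1, h2]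

/-- What a reduction provides on names: `H` yields names of instances of `g`, and `K` turns names
of their solutions into names of solutions of `f`. -/
theorem Reducible.exists_maps {X Y Z W : Type} [RepresentedSpace X] [RepresentedSpace Y]
    [RepresentedSpace Z] [RepresentedSpace W] {f : MultiMap X Y} {g : MultiMap Z W}
    (h : Reducible f g) : ∃ K H : Baire →. Baire, IsComputable K ∧ IsComputable H ∧
      ∀ p x, RepresentedSpace.names p x → (f x).Nonempty →
        ∃ r ∈ H p, ∃ w, RepresentedSpace.names r w ∧ (g w).Nonempty ∧
          ∀ z ∈ g w, ∀ q, RepresentedSpace.names q z →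
            ∃ o ∈ K (pairing p q), ∃ b, RepresentedSpace.names o b ∧ b ∈ f x := by
  classical
  obtain ⟨K, H, hK, hH, hKH⟩ := h
  refine ⟨K, H, hK, hH, fun p x hp hx => ?_⟩
  let S : Baire → Set Baire := fun r =>
    {q | ∃ w z, RepresentedSpace.names r w ∧ z ∈ g w ∧ RepresentedSpace.names q z}
  have key : ∀ G : Baire →. Baire, (∀ r, (S r).Nonempty → ∃ q ∈ G r, q ∈ S r) → Realizes G g := by
    rintro G hG r w hr ⟨z, hz⟩
    obtain ⟨q, hq⟩ := RepresentedSpace.surj z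
    obtain ⟨q', hq', w', z', hw', hz', hn⟩ := hG r ⟨q, w, z, hr, hz, hq⟩
    obtain rfl := RepresentedSpace.unique hr hw'
    exact ⟨q', hq', z', hn, hz'⟩
  -- `G₀` is undefined off the names of solvable instances, so its being defined at `r` shows that
  -- `r` is such a name.
  let G₀ : Baire →. Baire := fun r =>
    ⟨(S r).Nonempty, fun h => h.some⟩
  have hG₀ : Realizes G₀ g := key _ fun r hr => ⟨_, ⟨hr, rfl⟩, hr.some_mem⟩
  obtain ⟨o, ho, -⟩ := hKH G₀ hG₀ p x hp hx
  simp only [sandwich, Part.mem_bind_iff] at ho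
  obtain ⟨r, hr, q₀, ⟨⟨q₁, w, z₁, hw, hz₁, -⟩, -⟩, -⟩ := ho
  refine ⟨r, hr, w, hw, ⟨z₁, hz₁⟩, fun z hz q hq => ?_⟩
  -- Redefining the realizer at `r` alone makes `K` cope with any name of any solution.
  let G : Baire →. Baire := fun r' => if r' = r then Part.some q else G₀ r'
  have hG : Realizes G g := by
    refine key _ fun r' hr' => ?_
    by_cases h : r' = r
    · subst h
      exact ⟨q, by simp [G], w, z, hw, hz, hq⟩
    · exact ⟨hr'.some, by simpa [G, h] using ⟨hr', rfl⟩, hr'.some_mem⟩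
  obtain ⟨o, ho, b, hb⟩ := hKH G hG p x hp hx
  simp only [sandwich, Part.mem_bind_iff] at ho
  obtain ⟨r', hr', q', hq', ho⟩ := ho
  obtain rfl := Part.mem_unique hr hr'
  simp only [G, if_true, Part.mem_some_iff] at hq'
  subst hq'
  exact ⟨o, ho, b, hb⟩

/-! ### Cauchy names, open names and compact sets of names. -/

section Cauchy

variable {X : Type} [MetricSpace X] {α : ℕ → X}

theorem CauchyNames.dist_le {p : Baire} {x : X} (h : CauchyNames α p x) (i : ℕ) :
    dist (α (p i)) x ≤ (1 / 2 : ℝ) ^ i := by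
  refine le_of_tendsto (tendsto_const_nhds.dist h.2) ?_
  filter_upwards [eventually_gt_atTop i] with k hk using h.1 i k hk

theorem CauchyNames.dist_le_of_agree {p p' : Baire} {x x' : X} (h : CauchyNames α p x)
    (h' : CauchyNames α p' x') {i : ℕ} (hp : p i = p' i) :
    dist x x' ≤ 2 * (1 / 2 : ℝ) ^ i := by
  have h1 := h.dist_le i
  have h2 := h'.dist_le i
  rw [← hp] at h2
  linarith [dist_triangle_left x x' (α (p i))]

/-- The non-strict bound is a closed condition on `(p, x)`, as the compact set of names requires. -/
theorem cauchyNames_of_dist_le {p : Baire} {x : X}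
    (h : ∀ i, dist x (α (p i)) ≤ (1 / 2 : ℝ) ^ (i + 1)) : CauchyNames α p x := by
  refine ⟨fun i k hik => ?_, ?_⟩
  · have h3 : (1 / 2 : ℝ) ^ (k + 1) ≤ (1 / 2 : ℝ) ^ (i + 1) :=
      pow_le_pow_of_le_one (by norm_num) (by norm_num) (by omega)
    have h5 : (1 / 2 : ℝ) ^ (i + 1) + (1 / 2 : ℝ) ^ (i + 1) = (1 / 2 : ℝ) ^ i := by ring
    linarith [h i, h k, dist_triangle_left (α (p i)) (α (p k)) x]
  · rw [tendsto_iff_dist_tendsto_zero]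
    refine squeeze_zero (fun _ => dist_nonneg) (fun i => (dist_comm (α (p i)) x).le.trans (h i)) ?_
    exact (tendsto_pow_atTop_nhds_zero_of_lt_one (by norm_num) (by norm_num)).comp
      (tendsto_add_atTop_nat 1)

/-- Every point has a name `p` such that all points close to it have names close to `p`. -/
theorem exists_open_name (hα : DenseRange α) (x : X) : ∃ p, CauchyNames α p x ∧
    ∀ N, ∃ η > 0, ∀ x', dist x' x < η → ∃ p', CauchyNames α p' x' ∧ Agree N p' p := by
  -- Only half of the allowed error `2^{-(i+1)}` is spent; the rest lets a nearby point reuse the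
  -- first `N` entries.
  have h : ∀ (x : X) (i : ℕ), ∃ n, dist x (α n) < (1 / 2 : ℝ) ^ (i + 2) := fun x i =>
    hα.exists_dist_lt x (by positivity)
  choose name hname using h
  have hlt : ∀ i : ℕ, (1 / 2 : ℝ) ^ (i + 2) + (1 / 2 : ℝ) ^ (i + 2) = (1 / 2 : ℝ) ^ (i + 1) :=
    fun i => by ring
  have hpos : ∀ i : ℕ, 0 < (1 / 2 : ℝ) ^ (i + 2) := fun i => by positivity
  refine ⟨name x, cauchyNames_of_dist_le fun i => ?_, fun N => ⟨(1 / 2) ^ (N + 2), hpos N,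
    fun x' hx' => ⟨fun i => if i < N then name x i else name x' i,
      cauchyNames_of_dist_le fun i => ?_, fun i hi => by simp [hi]⟩⟩⟩
  · linarith [hname x i, hlt i, hpos i]
  · split_ifs with hi
    · have h3 : (1 / 2 : ℝ) ^ (N + 2) ≤ (1 / 2 : ℝ) ^ (i + 2) :=
        pow_le_pow_of_le_one (by norm_num) (by norm_num) (by omega)
      linarith [hname x i, hlt i, hpos i, dist_triangle x' x (α (name x i))]
    · linarith [hname x' i, hlt i, hpos i]

/-- A compact metric space has a compact set of names such that close points have close names. -/
theorem exists_compact_names [CompactSpace X] (hα : DenseRange α) : ∃ C : Set (Baire × X),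
    IsCompact C ∧ (∀ c ∈ C, CauchyNames α c.1 c.2) ∧
    ∀ N, ∃ δ > 0, ∀ z z', dist z z' < δ → ∃ q q', (q, z) ∈ C ∧ (q', z') ∈ C ∧ Agree N q q' := by
  -- Finitely many indices suffice at each precision, so names can be taken from a product of finite
  -- sets, which is compact.
  have h : ∀ i : ℕ, ∃ S : Finset ℕ, ∀ z, ∃ k ∈ S, dist z (α k) < (1 / 2 : ℝ) ^ (i + 2) := by
    intro i
    obtain ⟨S, hS⟩ := isCompact_univ.elim_finite_subcover
      (fun k => Metric.ball (α k) ((1 / 2 : ℝ) ^ (i + 2))) (fun _ => Metric.isOpen_ball) (by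
        intro z _
        obtain ⟨k, hk⟩ := hα.exists_dist_lt z (show (0 : ℝ) < (1 / 2) ^ (i + 2) by positivity)
        exact Set.mem_iUnion.2 ⟨k, hk⟩)
    refine ⟨S, fun z => ?_⟩
    simpa using hS (Set.mem_univ z)
  choose S hS using h
  choose name hnameS hname using fun (z : X) (i : ℕ) => hS i z
  have hlt : ∀ i : ℕ, (1 / 2 : ℝ) ^ (i + 2) + (1 / 2 : ℝ) ^ (i + 2) = (1 / 2 : ℝ) ^ (i + 1) :=
    fun i => by ring
  have hpos : ∀ i : ℕ, 0 < (1 / 2 : ℝ) ^ (i + 2) := fun i => by positivity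
  refine ⟨(Set.univ.pi fun i => (S i : Set ℕ)) ×ˢ Set.univ ∩
    {c | ∀ i, dist c.2 (α (c.1 i)) ≤ (1 / 2 : ℝ) ^ (i + 1)}, ?_, ?_, ?_⟩
  · refine ((isCompact_univ_pi fun i => (S i).finite_toSet.isCompact).prod
      isCompact_univ).inter_right ?_
    simp only [Set.ofPred_forall]
    refine isClosed_iInter fun i => isClosed_le ?_ continuous_const
    exact continuous_snd.dist
      (continuous_of_discreteTopology.comp ((continuous_apply i).comp continuous_fst))
  · exact fun c hc => cauchyNames_of_dist_le hc.2
  · refine fun N => ⟨(1 / 2) ^ (N + 2), hpos N, fun z z' hz => ⟨name z,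
      fun i => if i < N then name z i else name z' i, ⟨?_, fun i => ?_⟩, ⟨?_, fun i => ?_⟩,
      fun i hi => by simp [hi]⟩⟩
    · simpa using hnameS z
    · linarith [hname z i, hlt i, hpos i]
    · simp only [Set.mem_prod, Set.mem_pi, Set.mem_univ, and_true, true_implies]
      intro i
      split_ifs
      exacts [hnameS z i, hnameS z' i]
    · dsimp only
      split_ifs with hi
      · have h3 : (1 / 2 : ℝ) ^ (N + 2) ≤ (1 / 2 : ℝ) ^ (i + 2) :=
          pow_le_pow_of_le_one (by norm_num) (by norm_num) (by omega)
        linarith [hname z i, hlt i, hpos i, dist_triangle_left z' (α (name z i)) z]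
      · linarith [hname z' i, hlt i, hpos i]

end Cauchy

end Weihrauch

/-! ### The obstruction: wobbly problems, crossing problems and uniform continuity of a reduction.
-/

namespace Weihrauch

open RepresentedSpace

/-- A problem with an instance that has arbitrarily close instances with any prescribed point of
`[1/3, 2/3]` as unique solution. -/
def Wobbly {X : Type} [RepresentedSpace X] (f : MultiMap X unitInterval) : Prop :=
  ∃ p x, names p x ∧ (f x).Nonempty ∧ ∀ t : unitInterval, (t : ℝ) ∈ Set.Icc (1 / 3 : ℝ) (2 / 3) →
    ∀ N, ∃ p' x', names p' x' ∧ Agree N p' p ∧ f x' = {t}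

/-- A problem of finding, near every given instance, a zero of a continuous function that depends
continuously on the names of the instance and has opposite signs at `0` and `1`. -/
def Crossing {W : Type} [RepresentedSpace W] (g : MultiMap W unitInterval) : Prop :=
  ∀ r w, names r w → (g w).Nonempty → ∃ φ : W → C(unitInterval, ℝ),
    (∃ N, ∀ r' w', names r' w' → Agree N r' r → (g w').Nonempty →
      0 ≤ φ w' 0 ∧ φ w' 1 ≤ 0 ∧ g w' = {z | φ w' z = 0}) ∧
    ∀ r₁ w₁, names r₁ w₁ → ∀ η > 0, ∃ N, ∀ r' w', names r' w' → Agree N r' r₁ →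
      ∀ z, |φ w' z - φ w₁ z| < η

/-- A continuous function on `[0,1]` attains the value `0` between points of opposite signs. -/
theorem exists_zero_mem_Icc (ψ : C(unitInterval, ℝ)) {a b : unitInterval} (hab : a ≤ b)
    (ha : 0 ≤ ψ a) (hb : ψ b ≤ 0) : ∃ z ∈ Set.Icc a b, ψ z = 0 :=
  intermediate_value_Icc' hab ψ.continuous.continuousOn ⟨hb, ha⟩

/-- Strict signs on both sides survive small perturbations, which a mere zero need not. -/
theorem exists_sign_change {n : ℕ} {s : ℕ → ℝ} (hs : ∀ j ≤ n, s j ≠ 0) (h0 : 0 ≤ s 0)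
    (hn : s n ≤ 0) : ∃ j < n, 0 < s j ∧ s (j + 1) < 0 := by
  by_contra! h
  have : ∀ j ≤ n, 0 < s j := by
    intro j
    induction j with
    | zero => exact fun hj => lt_of_le_of_ne h0 (hs 0 hj).symm
    | succ j ih => exact fun hj => lt_of_le_of_ne (h j hj (ih (by omega))) (hs _ hj).symm
  exact absurd (this n le_rfl) hn.not_gt

theorem agree_mem_nhds {Z : Type} [TopologicalSpace Z] (N : ℕ) (c : Baire × Z) :
    {c' : Baire × Z | Agree N c'.1 c.1} ∈ 𝓝 c := by
  have h : IsOpen (⋂ i ∈ Set.Iio N, {c' : Baire × Z | c'.1 i = c.1 i}) := by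
    refine (Set.finite_Iio N).isOpen_biInter fun i _ => ?_
    have hc : Continuous fun c' : Baire × Z => c'.1 i := (continuous_apply i).comp continuous_fst
    exact (isOpen_discrete {c.1 i}).preimage hc
  refine mem_of_superset (h.mem_nhds (by simp)) fun c' hc' i hi => ?_
  simpa using Set.mem_iInter₂.1 hc' i hi

section

variable {X Y W : Type} [RepresentedSpace X] [RepresentedSpace W]

/-- The names of instances of `f` which `H` translates to instances of `g` that `z` solves. -/
def SolvedBy (H : Baire →. Baire) (g : MultiMap W unitInterval) (p : Baire) (z : unitInterval) :
    Prop :=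
  ∃ r ∈ H p, ∃ w, names r w ∧ z ∈ g w

/-- `K` and `H` witness a reduction of `f` to `g`, on the level of names. -/
def Reduces [RepresentedSpace Y] (K H : Baire →. Baire) (f : MultiMap X Y)
    (g : MultiMap W unitInterval) : Prop :=
  ∀ p x, names p x → (f x).Nonempty → ∃ r ∈ H p, ∃ w, names r w ∧ (g w).Nonempty ∧
    ∀ z ∈ g w, ∀ q, names q z → ∃ o ∈ K (pairing p q), ∃ b, names o b ∧ b ∈ f x

/-- Names close to the name of a given point are names of points close to it. -/
theorem exists_agree_dist_le {o : Baire} {b : unitInterval × unitInterval} (h : names o b)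
    {ε : ℝ} (hε : 0 < ε) : ∃ m, ∀ o' b', names o' b' → Agree m o' o → dist b' b ≤ ε := by
  obtain ⟨i, hi⟩ := exists_pow_lt_of_lt_one (half_pos hε) (by norm_num : (1 / 2 : ℝ) < 1)
  -- The `i`-th entries of the two components sit at positions `2i` and `2i + 1`.
  refine ⟨2 * i + 2, fun o' b' h' ho => ?_⟩
  have h1 := CauchyNames.dist_le_of_agree h'.1 h.1 (ho (2 * i) (by omega))
  have h2 := CauchyNames.dist_le_of_agree h'.2 h.2 (ho (2 * i + 1) (by omega))
  rw [Prod.dist_eq]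
  exact max_le (by linarith) (by linarith)

variable {f : MultiMap X (unitInterval × unitInterval)} {g : MultiMap W unitInterval}
  {K H : Baire →. Baire} {p₀ : Baire} {x₀ : X}

/-- Points that are not solutions stay so for nearby instances. -/
theorem exists_agree_not_solvedBy (hH : IsComputable H) (hg : Crossing g)
    (hred : Reduces K H f g) (hp₀ : names p₀ x₀) (hx₀ : (f x₀).Nonempty) {q : Baire}
    {z : unitInterval} (hq : names q z) (hz : ¬ SolvedBy H g p₀ z) :
    ∃ k, ∀ p, Agree k p p₀ → ∀ q' z', names q' z' → Agree k q' q → ¬ SolvedBy H g p z' := by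
  obtain ⟨r₀, hr₀, w₀, hw₀, hne, -⟩ := hred p₀ x₀ hp₀ hx₀
  obtain ⟨φ, ⟨N, hN⟩, hφ⟩ := hg r₀ w₀ hw₀ hne
  have hz0 : φ w₀ z ≠ 0 := fun h => hz ⟨r₀, hr₀, w₀, hw₀, by
    rw [(hN r₀ w₀ hw₀ (Agree.refl _ _) hne).2.2]
    exact h⟩
  -- Half of the margin absorbs the change of instance, half the move from `z` to `z'`.
  have hpos : 0 < |φ w₀ z| / 2 := by positivity
  obtain ⟨M, hM⟩ := hφ r₀ w₀ hw₀ _ hpos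
  obtain ⟨δ, hδ, hδ'⟩ := Metric.continuous_iff.1 (φ w₀).continuous z _ hpos
  obtain ⟨i, hi⟩ := exists_pow_lt_of_lt_one (half_pos hδ) (by norm_num : (1 / 2 : ℝ) < 1)
  obtain ⟨k, hk⟩ := hH.continuous hr₀ (max N M)
  refine ⟨max k (i + 1), fun p hp q' z' hq' hqq' ⟨r, hr, w, hw, hzw⟩ => ?_⟩
  have hagree := hk p r (hp.mono (le_max_left _ _)) hr
  have h1 : φ w z' = 0 := by
    rw [(hN r w hw (hagree.mono (le_max_left _ _)) ⟨z', hzw⟩).2.2] at hzw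
    exact hzw
  have h2 := hM r w hw (hagree.mono (le_max_right _ _)) z'
  have h3 : dist z' z < δ := by
    have := CauchyNames.dist_le_of_agree hq' hq
      (hqq' i ((Nat.lt_succ_self i).trans_le (le_max_right _ _)))
    linarith
  have h4 := hδ' z' h3
  rw [Real.dist_eq] at h4
  rw [h1, zero_sub, abs_neg] at h2
  have h5 := abs_sub_abs_le_abs_sub (φ w₀ z) (φ w₀ z')
  rw [abs_sub_comm] at h5
  linarith

/-- For names of instances near a given one and nearby names, from a compact set, of solutions of
their translations, the reduction yields nearby solutions. -/
theorem outputs_close (hK : IsComputable K) (hH : IsComputable H) (hg : Crossing g)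
    (hred : Reduces K H f g) (hp₀ : names p₀ x₀) (hx₀ : (f x₀).Nonempty)
    {C : Set (Baire × unitInterval)} (hC : IsCompact C) (hCn : ∀ c ∈ C, names c.1 c.2)
    {ε : ℝ} (hε : 0 < ε) :
    ∃ N, ∀ p x p' x', names p x → (f x).Nonempty → names p' x' → (f x').Nonempty →
      Agree N p p₀ → Agree N p' p₀ → ∀ q z q' z', (q, z) ∈ C → (q', z') ∈ C → Agree N q q' →
      SolvedBy H g p z → SolvedBy H g p' z' → ∃ b ∈ f x, ∃ b' ∈ f x', dist b b' ≤ ε := by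
  have hout : ∀ p x, names p x → (f x).Nonempty → ∀ q z, names q z → SolvedBy H g p z →
      ∃ o ∈ K (pairing p q), ∃ b, names o b ∧ b ∈ f x := by
    rintro p x hp hx q z hq ⟨r, hr, w, hw, hz⟩
    obtain ⟨r', hr', w', hw', -, h⟩ := hred p x hp hx
    obtain rfl := Part.mem_unique hr hr'
    obtain rfl := unique hw hw'
    exact h z hz q hq
  -- At a solution for `p₀`, continuity of `K` pins down the output. At a non-solution `K` may be
  -- undefined, but then no nearby name is a solution either. Compactness of `C` makes `k` uniform.
  have hloc : ∀ c : Baire × unitInterval, ∃ k, c ∈ C →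
      (∀ p, Agree k p p₀ → ∀ q' z', names q' z' → Agree k q' c.1 → ¬ SolvedBy H g p z') ∨
      ∃ b, ∀ p x, names p x → (f x).Nonempty → Agree k p p₀ → ∀ q z, names q z →
        Agree k q c.1 → SolvedBy H g p z → ∃ b' ∈ f x, dist b' b ≤ ε / 2 := by
    intro c
    by_cases hc : c ∈ C
    swap
    · exact ⟨0, fun h => absurd h hc⟩
    by_cases hs : SolvedBy H g p₀ c.2
    · obtain ⟨o, ho, b, hob, -⟩ := hout p₀ x₀ hp₀ hx₀ c.1 c.2 (hCn c hc) hs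
      obtain ⟨m, hm⟩ := exists_agree_dist_le hob (half_pos hε)
      obtain ⟨k, hk⟩ := hK.continuous ho m
      refine ⟨k, fun _ => Or.inr ⟨b, fun p x hp hx hpp q z hq hqq hsol => ?_⟩⟩
      obtain ⟨o', ho', b', hob', hb'⟩ := hout p x hp hx q z hq hsol
      exact ⟨b', hb', hm o' b' hob' (hk _ _ (hpp.pairing hqq) ho')⟩
    · obtain ⟨k, hk⟩ := exists_agree_not_solvedBy hH hg hred hp₀ hx₀ (hCn c hc) hs
      exact ⟨k, fun _ => Or.inl hk⟩
  choose k hk using hloc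
  obtain ⟨t, htC, ht⟩ := hC.elim_nhds_subcover
    (fun c => {c' | Agree (k c) c'.1 c.1}) fun c _ => agree_mem_nhds (k c) c
  refine ⟨t.sup k, fun p x p' x' hp hx hp' hx' hpp hpp' q z q' z' hq hq' hqq hs hs' => ?_⟩
  obtain ⟨c, hc, hqc⟩ := Set.mem_iUnion₂.1 (ht hq)
  have hle : k c ≤ t.sup k := Finset.le_sup hc
  have hqc' : Agree (k c) q' c.1 := ((hqq.mono hle).symm).trans hqc
  rcases hk c (htC c hc) with h | ⟨b, h⟩
  · exact absurd hs (h p (hpp.mono hle) q z (hCn (q, z) hq) hqc)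
  · obtain ⟨b₁, hb₁, hd₁⟩ := h p x hp hx (hpp.mono hle) q z (hCn (q, z) hq) hqc hs
    obtain ⟨b₂, hb₂, hd₂⟩ := h p' x' hp' hx' (hpp'.mono hle) q' z' (hCn (q', z') hq') hqc' hs'
    exact ⟨b₁, hb₁, b₂, hb₂, by linarith [dist_triangle_right b₁ b₂ b]⟩

end

/-! ### The grid argument. -/

theorem names_pairing {X Y : Type} [RepresentedSpace X] [RepresentedSpace Y] {p q : Baire} {x : X}
    {y : Y} (hp : names p x) (hq : names q y) : names (pairing p q) (x, y) :=
  ⟨by simpa only [pairing_even] using hp, by simpa only [pairing_odd] using hq⟩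

/-- The grid point `j / n` of the unit interval. -/
noncomputable def gridPoint (n j : ℕ) : unitInterval :=
  Set.projIcc (0 : ℝ) 1 zero_le_one ((j : ℝ) / n)

theorem coe_gridPoint {n j : ℕ} (hj : j ≤ n) : (gridPoint n j : ℝ) = j / n := by
  rw [gridPoint, Set.projIcc_of_mem]
  exact ⟨by positivity, div_le_one_of_le₀ (by exact_mod_cast hj) (by positivity)⟩

/-- The product of a wobbly problem with itself is not reducible to a problem of finding zeros of
functions that change their sign. -/
theorem not_reducible_prod {X W : Type} [RepresentedSpace X] [RepresentedSpace W]
    {f : MultiMap X unitInterval} {g : MultiMap W unitInterval} (hf : Wobbly f)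
    (hg : Crossing g) : ¬ Reducible (prod f f) g := by
  intro hfg
  obtain ⟨K, H, hK, hH, hred⟩ := hfg.exists_maps
  obtain ⟨u₀, x₀, hu₀, hx₀, hwob⟩ := hf
  have hp₀ := names_pairing hu₀ hu₀
  have ha₀ : (prod f f (x₀, x₀)).Nonempty := hx₀.prod hx₀
  obtain ⟨r₀, hr₀, w₀, hw₀, hne₀, -⟩ := hred _ _ hp₀ ha₀
  obtain ⟨φ, ⟨Nc, hNc⟩, hφ⟩ := hg r₀ w₀ hw₀ hne₀
  obtain ⟨kc, hkc⟩ := hH.continuous hr₀ Nc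
  obtain ⟨C, hC, hCn, hCδ⟩ := exists_compact_names ratPoint_dense
  obtain ⟨N₁, hN₁⟩ := outputs_close hK hH hg hred hp₀ ha₀ hC hCn (show (0 : ℝ) < 1 / 6 by norm_num)
  obtain ⟨δ, hδ, hδ'⟩ := hCδ N₁
  obtain ⟨n, hn⟩ := exists_nat_one_div_lt hδ
  -- This tolerance is half the spacing of the `n + 3` targets used below; it may depend on `n`
  -- because the grid is already fixed.
  obtain ⟨N₂, hN₂⟩ := outputs_close hK hH hg hred hp₀ ha₀ hC hCn
    (show (0 : ℝ) < 1 / (6 * (n + 3)) by positivity)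
  let N := max kc (max N₁ N₂)
  have hNk : kc ≤ N := le_max_left _ _
  have hN1 : N₁ ≤ N := (le_max_left _ _).trans (le_max_right _ _)
  have hN2 : N₂ ≤ N := (le_max_right _ _).trans (le_max_right _ _)
  -- instances whose first component has a prescribed unique solution are solved by grid points
  have key : ∀ t : unitInterval, (t : ℝ) ∈ Set.Icc (1 / 3 : ℝ) (2 / 3) →
      ∃ j ≤ n + 1, ∃ p a, names p a ∧ Agree N p (pairing u₀ u₀) ∧ (prod f f a).Nonempty ∧
        f a.1 = {t} ∧ SolvedBy H g p (gridPoint (n + 1) j) := by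
    intro t ht
    obtain ⟨u, x, hu, huu, hfx⟩ := hwob t ht N
    have hx : (f x).Nonempty := by simp [hfx]
    have hp := names_pairing hu hu₀
    have hpp : Agree N (pairing u u₀) (pairing u₀ u₀) := huu.pairing (Agree.refl _ _)
    obtain ⟨r, hr, w, hw, hne, -⟩ := hred _ _ hp (hx.prod hx₀)
    obtain ⟨h0, h1, hgw⟩ := hNc r w hw (hkc _ _ (hpp.mono hNk) hr) hne
    by_contra! hcon
    have hnz : ∀ j ≤ n + 1, φ w (gridPoint (n + 1) j) ≠ 0 := fun j hj hz =>
      hcon j hj _ _ hp hpp (hx.prod hx₀) hfx ⟨r, hr, w, hw, by rw [hgw]; exact hz⟩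
    have hg0 : gridPoint (n + 1) 0 = 0 := by
      ext
      simp [coe_gridPoint (Nat.zero_le (n + 1))]
    have hg1 : gridPoint (n + 1) (n + 1) = 1 := by
      ext
      rw [coe_gridPoint le_rfl, div_self (by positivity), Set.Icc.coe_one]
    obtain ⟨j, hj, hj0, hj1⟩ := exists_sign_change hnz (by rwa [hg0]) (by rwa [hg1])
    -- Changes below both margins keep the signs at the two ends of the cell.
    obtain ⟨M, hM⟩ := hφ r w hw _ (lt_min hj0 (neg_pos.2 hj1))
    obtain ⟨k, hk⟩ := hH.continuous hr M
    have hcj : (gridPoint (n + 1) j : ℝ) = j / ((n : ℝ) + 1) := by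
      rw [coe_gridPoint hj.le]
      push_cast
      rfl
    have hcj1 : (gridPoint (n + 1) (j + 1) : ℝ) = j / ((n : ℝ) + 1) + 1 / ((n : ℝ) + 1) := by
      rw [coe_gridPoint hj]
      push_cast
      ring
    have hle : gridPoint (n + 1) j ≤ gridPoint (n + 1) (j + 1) := by
      rw [← Subtype.coe_le_coe, hcj, hcj1]
      exact le_add_of_nonneg_right (by positivity)
    -- the translated instance has a solution in one cell of the grid, however it is perturbed
    have pert : ∀ s : unitInterval, (s : ℝ) ∈ Set.Icc (1 / 3 : ℝ) (2 / 3) →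
        ∃ p a, names p a ∧ Agree N p (pairing u₀ u₀) ∧ (prod f f a).Nonempty ∧ f a.2 = {s} ∧
          ∃ z ∈ Set.Icc (gridPoint (n + 1) j) (gridPoint (n + 1) (j + 1)), SolvedBy H g p z := by
      intro s hs
      -- Agreement up to `N` stays where `φ` describes the solutions; agreement up to `k` preserves
      -- the sign change.
      obtain ⟨v, y, hv, hvv, hfy⟩ := hwob s hs (max N k)
      have hy : (f y).Nonempty := by simp [hfy]
      have hp' := names_pairing hu hv
      have hpp' : Agree N (pairing u v) (pairing u₀ u₀) :=
        huu.pairing (hvv.mono (le_max_left _ _))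
      obtain ⟨r', hr', w', hw', hne', -⟩ := hred _ _ hp' (hx.prod hy)
      obtain ⟨-, -, hgw'⟩ := hNc r' w' hw' (hkc _ _ (hpp'.mono hNk) hr') hne'
      have hclose := hM r' w' hw'
        (hk _ _ ((Agree.refl k u).pairing (hvv.mono (le_max_right _ _))) hr')
      have hc0 := abs_lt.1 ((hclose (gridPoint (n + 1) j)).trans_le (min_le_left _ _))
      have hc1 := abs_lt.1 ((hclose (gridPoint (n + 1) (j + 1))).trans_le (min_le_right _ _))
      obtain ⟨z, hz, hz0⟩ := exists_zero_mem_Icc (φ w') hle (by linarith) (by linarith)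
      exact ⟨_, _, hp', hpp', hx.prod hy, hfy, z, hz, r', hr', w', hw', by rw [hgw']; exact hz0⟩
    -- The second outputs are forced to be `1/3` and `2/3`, too far apart for the tolerance `1/6`.
    obtain ⟨p, a, hpa, hpN, hane, has, z, hz, hsol⟩ :=
      pert ⟨1 / 3, by norm_num, by norm_num⟩ ⟨le_rfl, by norm_num⟩
    obtain ⟨p', a', hpa', hpN', hane', has', z', hz', hsol'⟩ :=
      pert ⟨2 / 3, by norm_num, by norm_num⟩ ⟨by norm_num, le_rfl⟩
    have hzz : dist z z' < δ := by
      refine lt_of_le_of_lt ?_ hn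
      rw [Subtype.dist_eq, Real.dist_eq, abs_le]
      simp only [Set.mem_Icc, ← Subtype.coe_le_coe, hcj, hcj1] at hz hz'
      constructor <;> linarith [hz.1, hz.2, hz'.1, hz'.2]
    obtain ⟨q, q', hq, hq', hqq⟩ := hδ' z z' hzz
    obtain ⟨b, hb, b', hb', hbb⟩ := hN₁ p a p' a' hpa hane hpa' hane' (hpN.mono hN1)
      (hpN'.mono hN1) q z q' z' hq hq' hqq hsol hsol'
    have hb2 : b.2 ∈ f a.2 := hb.2
    have hb2' : b'.2 ∈ f a'.2 := hb'.2
    rw [has, Set.mem_singleton_iff] at hb2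
    rw [has', Set.mem_singleton_iff] at hb2'
    have := (le_max_right _ _).trans (Prod.dist_eq.symm.le.trans hbb)
    rw [hb2, hb2', Subtype.dist_eq, Real.dist_eq, abs_le] at this
    norm_num at this
  have hmem : ∀ i : Fin (n + 3),
      (1 / 3 + (i : ℝ) / (3 * (n + 3)) : ℝ) ∈ Set.Icc (1 / 3 : ℝ) (2 / 3) := by
    intro i
    have hi : ((i : ℕ) : ℝ) ≤ n + 3 := by exact_mod_cast i.2.le
    have hd : (i : ℝ) / (3 * (n + 3)) ≤ 1 / 3 := by
      rw [div_le_div_iff₀ (by positivity) (by norm_num)]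
      linarith
    have : (0 : ℝ) ≤ (i : ℝ) / (3 * (n + 3)) := by positivity
    constructor <;> linarith
  choose j hj p a hpa hpN hane hat hsol using fun i : Fin (n + 3) =>
    key ⟨1 / 3 + (i : ℝ) / (3 * (n + 3)), by linarith [(hmem i).1], by linarith [(hmem i).2]⟩
      (hmem i)
  -- There are `n + 3` targets but only `n + 2` grid points.
  obtain ⟨i, -, i', -, hii, hjj⟩ := Finset.exists_ne_map_eq_of_card_lt_of_maps_to
    (s := Finset.univ) (t := Finset.range (n + 2)) (f := j) (by simp)
    fun i _ => Finset.mem_coe.2 (Finset.mem_range.2 (Nat.lt_succ_of_le (hj i)))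
  -- Comparing the grid point with itself supplies a name of it in `C`, used for both instances.
  obtain ⟨q, -, hq, -, -⟩ := hδ' (gridPoint (n + 1) (j i)) (gridPoint (n + 1) (j i))
    (by rwa [dist_self])
  obtain ⟨b, hb, b', hb', hbb⟩ := hN₂ _ _ _ _ (hpa i) (hane i) (hpa i') (hane i')
    ((hpN i).mono hN2) ((hpN i').mono hN2) q _ q _ hq hq (Agree.refl _ _) (hsol i)
    (by rw [hjj]; exact hsol i')
  have hb1 : b.1 ∈ f (a i).1 := hb.1
  have hb1' : b'.1 ∈ f (a i').1 := hb'.1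
  rw [hat, Set.mem_singleton_iff] at hb1 hb1'
  have hd := (le_max_left _ _).trans (Prod.dist_eq.symm.le.trans hbb)
  rw [hb1, hb1', Subtype.dist_eq, Real.dist_eq] at hd
  have hone : (1 : ℝ) ≤ |(i : ℝ) - (i' : ℝ)| := by
    have : (1 : ℤ) ≤ |((i : ℕ) : ℤ) - ((i' : ℕ) : ℤ)| :=
      Int.one_le_abs (sub_ne_zero.2 fun h => hii (Fin.ext (by exact_mod_cast h)))
    exact_mod_cast this
  have heq : (1 / 3 + (i : ℝ) / (3 * (n + 3)) : ℝ) - (1 / 3 + (i' : ℝ) / (3 * (n + 3))) =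
      ((i : ℝ) - i') / (3 * (n + 3)) := by ring
  have hpos : (0 : ℝ) < n + 3 := by positivity
  simp only [heq] at hd
  rw [abs_div, abs_of_pos (by positivity : (0 : ℝ) < 3 * (n + 3)),
    div_le_div_iff₀ (by positivity) (by positivity)] at hd
  nlinarith

end Weihrauch

/-! ### Fixed points and zeros as crossing and wobbly problems. -/

namespace Weihrauch

open RepresentedSpace

theorem abs_apply_sub_le_of_agree {p p' : Baire} {x x' : C(unitInterval, ℝ)} (h : names p x)
    (h' : names p' x') {η : ℝ} {i : ℕ} (hi : (1 / 2 : ℝ) ^ i < η / 2) (hp : Agree (i + 1) p' p)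
    (z : unitInterval) : |x' z - x z| < η := by
  have h1 := CauchyNames.dist_le_of_agree h' h (hp i (Nat.lt_succ_self i))
  have h2 := ContinuousMap.dist_apply_le_dist (f := x') (g := x) z
  rw [Real.dist_eq] at h2
  linarith

theorem exists_agree_abs_lt {r : Baire} {w : C(unitInterval, ℝ)} (h : names r w) {η : ℝ}
    (hη : 0 < η) : ∃ N, ∀ r' (w' : C(unitInterval, ℝ)), names r' w' → Agree N r' r →
      ∀ z, |w' z - w z| < η := by
  obtain ⟨i, hi⟩ := exists_pow_lt_of_lt_one (half_pos hη) (by norm_num : (1 / 2 : ℝ) < 1)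
  exact ⟨i + 1, fun r' w' h' ha z => abs_apply_sub_le_of_agree h h' hi ha z⟩

/-- The function `f(x) - x` works for all instances at once, since `f` takes values in `[0,1]`. -/
theorem bft1_crossing : Crossing BFT1 := by
  let ι : C(unitInterval, ℝ) := ⟨fun x => (x : ℝ), by fun_prop⟩
  intro r w _ _
  refine ⟨fun w => toReal w - ι, ⟨0, fun r' w' _ _ _ => ⟨?_, ?_, ?_⟩⟩, fun r₁ w₁ h η hη => ?_⟩
  · simpa [ι, toReal] using (w' 0).2.1
  · simpa [ι, toReal] using (w' 1).2.2
  · ext z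
    simp [BFT1, ι, toReal, sub_eq_zero, Subtype.ext_iff]
  · obtain ⟨N, hN⟩ := exists_agree_abs_lt (w := toReal w₁) h hη
    refine ⟨N, fun r' w' h' ha z => ?_⟩
    simpa using hN r' (toReal w') h' ha z

/-- The orientation of the sign change is only locally constant, so the sign `σ` is fixed by the
given instance. -/
theorem ivt_crossing : Crossing IVT := by
  rintro r w hw ⟨z, hz, -⟩
  obtain ⟨σ, hσ, hσ0, hσ1⟩ : ∃ σ : ℝ, |σ| = 1 ∧ 0 < σ * w 0 ∧ σ * w 1 < 0 := by
    rcases mul_neg_iff.1 hz with ⟨h0, h1⟩ | ⟨h0, h1⟩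
    · exact ⟨1, by simp, by simpa using h0, by simpa using h1⟩
    · exact ⟨-1, by simp, by simpa using h0, by simpa using h1⟩
  have hσne : σ ≠ 0 := by
    rintro rfl
    simp at hσ
  have hφ : ∀ r₁ (w₁ : C(unitInterval, ℝ)), names r₁ w₁ → ∀ η > 0, ∃ N,
      ∀ r' (w' : C(unitInterval, ℝ)), names r' w' → Agree N r' r₁ → ∀ z, |(σ • w') z - (σ • w₁) z| < η := by
    intro r₁ w₁ h η hη
    obtain ⟨N, hN⟩ := exists_agree_abs_lt h hη
    refine ⟨N, fun r' w' h' ha z => ?_⟩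
    simpa [← mul_sub, abs_mul, hσ] using hN r' w' h' ha z
  obtain ⟨N, hN⟩ := hφ r w hw _ (lt_min hσ0 (neg_pos.2 hσ1))
  refine ⟨fun w => σ • w, ⟨N, ?_⟩, hφ⟩
  rintro r' w' h' ha ⟨y, hy, -⟩
  have h0 := abs_lt.1 ((hN r' w' h' ha 0).trans_le (min_le_left _ _))
  have h1 := abs_lt.1 ((hN r' w' h' ha 1).trans_le (min_le_right _ _))
  simp only [ContinuousMap.smul_apply, smul_eq_mul] at h0 h1 ⊢
  refine ⟨by linarith, by linarith, ?_⟩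
  ext x
  simp [IVT, hy, hσne]

/-- A deformation `F s` of a function passes, for small `s`, through functions that have names
close to a given open name of it. -/
theorem exists_agree_deformation {x₀ : C(unitInterval, ℝ)} {p : Baire}
    (hp : ∀ N, ∃ η > 0, ∀ x', dist x' x₀ < η → ∃ p', names p' x' ∧ Agree N p' p)
    {F : ℝ → C(unitInterval, ℝ)} (hF : ∀ s ∈ Set.Ioo (0 : ℝ) 1, dist (F s) x₀ ≤ s) (N : ℕ) :
    ∃ p', ∃ s ∈ Set.Ioo (0 : ℝ) 1, names p' (F s) ∧ Agree N p' p := by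
  obtain ⟨η, hη, h⟩ := hp N
  have hs : min (η / 2) (1 / 2) ∈ Set.Ioo (0 : ℝ) 1 :=
    ⟨lt_min (half_pos hη) (by norm_num), (min_le_right _ _).trans_lt (by norm_num)⟩
  obtain ⟨p', hp', ha⟩ := h (F _) <|
    (hF _ hs).trans_lt ((min_le_left _ _).trans_lt (half_lt_self hη))
  exact ⟨p', _, hs, hp', ha⟩

/-- Every point is fixed by the identity; moving each `y` a fraction `s` of the way to `t` leaves
only `t` fixed. -/
theorem bft1_wobbly : Wobbly BFT1 := by
  obtain ⟨p, hp, hopen⟩ := exists_open_name polySeq_dense (toReal (ContinuousMap.id unitInterval))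
  refine ⟨p, ContinuousMap.id _, hp, ⟨0, rfl⟩, fun t _ N => ?_⟩
  let F : ℝ → C(unitInterval, ℝ) := fun s => ⟨fun y => y + s * (t - y), by fun_prop⟩
  have hF : ∀ s ∈ Set.Ioo (0 : ℝ) 1, dist (F s) (toReal (ContinuousMap.id unitInterval)) ≤ s := by
    intro s hs
    rw [ContinuousMap.dist_le hs.1.le]
    intro y
    have h1 : |(t : ℝ) - y| ≤ 1 := by
      rw [abs_le]
      constructor <;> linarith [t.2.1, t.2.2, y.2.1, y.2.2]
    simp only [F, toReal, ContinuousMap.coe_mk, ContinuousMap.id_apply, Real.dist_eq,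
      add_sub_cancel_left, abs_mul, abs_of_pos hs.1]
    exact mul_le_of_le_one_right hs.1.le h1
  obtain ⟨p', s, hs, hp', ha⟩ := exists_agree_deformation hopen hF N
  have hmem : ∀ y : unitInterval, F s y ∈ unitInterval := fun y => by
    simp only [F, ContinuousMap.coe_mk]
    constructor
    · nlinarith [mul_nonneg hs.1.le t.2.1, mul_nonneg (sub_nonneg.2 hs.2.le) y.2.1]
    · nlinarith [mul_nonneg hs.1.le (sub_nonneg.2 t.2.2),
        mul_nonneg (sub_nonneg.2 hs.2.le) (sub_nonneg.2 y.2.2)]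
  refine ⟨p', ⟨fun y => ⟨F s y, hmem y⟩, by fun_prop⟩, hp', ha, ?_⟩
  ext y
  simp [BFT1, F, Subtype.ext_iff, hs.1.ne', sub_eq_zero, eq_comm]

/-- With `c` clamping to `[1/3, 2/3]`, `y - c y` vanishes exactly there. The tilt `s * (y - t)`
never opposes its sign when `t` lies on this plateau, so only the zero `t` remains. -/
theorem ivt_wobbly : Wobbly IVT := by
  let c : ℝ → ℝ := fun y => max (1 / 3) (min y (2 / 3))
  let x₀ : C(unitInterval, ℝ) := ⟨fun y => y - c y, by fun_prop⟩
  have c0 : c 0 = 1 / 3 := by norm_num [c]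
  have c1 : c 1 = 2 / 3 := by norm_num [c]
  obtain ⟨p, hp, hopen⟩ := exists_open_name polySeq_dense x₀
  refine ⟨p, x₀, hp, ⟨⟨1 / 2, by norm_num, by norm_num⟩, ?_, ?_⟩, fun t ht N => ?_⟩
  · norm_num [x₀, c0, c1]
  · norm_num [x₀, c]
  let F : ℝ → C(unitInterval, ℝ) := fun s => ⟨fun y => y - c y + s * (y - t), by fun_prop⟩
  have hF : ∀ s ∈ Set.Ioo (0 : ℝ) 1, dist (F s) x₀ ≤ s := by
    intro s hs
    rw [ContinuousMap.dist_le hs.1.le]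
    intro y
    have h1 : |(y : ℝ) - t| ≤ 1 := by
      rw [abs_le]
      constructor <;> linarith [t.2.1, t.2.2, y.2.1, y.2.2]
    simp only [F, x₀, ContinuousMap.coe_mk, Real.dist_eq, add_sub_cancel_left, abs_mul,
      abs_of_pos hs.1]
    exact mul_le_of_le_one_right hs.1.le h1
  obtain ⟨p', s, hs, hp', ha⟩ := exists_agree_deformation hopen hF N
  refine ⟨p', F s, hp', ha, ?_⟩
  ext y
  have hdom : F s 0 * F s 1 < 0 := by
    simp only [F, ContinuousMap.coe_mk, Set.Icc.coe_zero, Set.Icc.coe_one, c0, c1]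
    exact mul_neg_of_neg_of_pos (by nlinarith [ht.1, hs.1]) (by nlinarith [ht.2, hs.1])
  simp only [IVT, hdom, true_and, Set.mem_ofPred_eq, Set.mem_singleton_iff]
  simp only [F, ContinuousMap.coe_mk, Subtype.ext_iff]
  constructor
  · intro h
    rcases lt_trichotomy (y : ℝ) t with hlt | heq | hgt
    · have : (y : ℝ) ≤ c y := (le_min le_rfl (hlt.le.trans ht.2)).trans (le_max_right _ _)
      nlinarith [mul_pos hs.1 (sub_pos.2 hlt)]
    · exact heq
    · have : c y ≤ (y : ℝ) := max_le (ht.1.trans hgt.le) (min_le_left _ _)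
      nlinarith [mul_pos hs.1 (sub_pos.2 hgt)]
  · intro h
    have : c t = t := by simp only [c, min_eq_left ht.2, max_eq_right ht.1]
    rw [h, this]
    ring

end Weihrauch

theorem corollary7p4 :
    (¬ Weihrauch.Idempotent Weihrauch.BFT1 ∧
      Weihrauch.StrictlyReducible Weihrauch.BFT1
        (Weihrauch.prod Weihrauch.BFT1 Weihrauch.BFT1)) ∧
    (¬ Weihrauch.Idempotent Weihrauch.IVT ∧
      Weihrauch.StrictlyReducible Weihrauch.IVT
        (Weihrauch.prod Weihrauch.IVT Weihrauch.IVT)) := by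
  have hB := Weihrauch.not_reducible_prod Weihrauch.bft1_wobbly Weihrauch.bft1_crossing
  have hI := Weihrauch.not_reducible_prod Weihrauch.ivt_wobbly Weihrauch.ivt_crossing
  exact ⟨⟨fun h => hB h.2, Weihrauch.reducible_prod_self _, hB⟩,
    ⟨fun h => hI h.2, Weihrauch.reducible_prod_self _, hI⟩⟩
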